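/- Let $\Delta_{\mathbb N}$ be the set of probability distributions on $\mathbb N$. For $\mu,\nu\in\Delta_{\mathbb N}$ put $\|\mu-\nu\|_{TV}=\frac12\sum_{i}|\mu(i)-\nu(i)|$. For $f:\mathbb N\to[0,1]$ put $\|f\|_{1/2}=\bigl(\sum_i\sqrt{f(i)}\bigr)^2\in[0,\infty]$. For $\mu\in\Delta_{\mathbb N}$ and $0<\eta<1$, let $\mu^{\downarrow}(1)\ge\mu^{\downarrow}(2)\ge\cdots$ be the masses of $\mu$ listed in non-increasing order, let $T_\mu(\eta)$ be the least $t$ with $\sum_{i>t}\mu^{\downarrow}(i)<\eta$, and let $\mu[\eta]$ be the restriction of $\mu$ to its $T_\mu(\eta)$ heaviest points (ties broken in favour of the smaller point), equal to $0$ at all other points. For $X=(X_1,\dots,X_m)$ drawn i.i.d. from $\mu$ (written $X\sim\mu^m$), let $\widehat\mu_m(i)=\frac1m\#\{t\le m: X_t=i\}$ be the empirical measure (the MLE). **Upper bound.** There is a universal constant $C>0$ such that for all $\Lambda\ge2$, all $0<\varepsilon,\delta<1$, all $\mu\in\Delta_{\mathbb N}$ with $\|\mu[2\varepsilon\delta/9]\|_{1/2}\le\Lambda$,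 and all $m\ge\frac{C}{\varepsilon^2}\max\{\Lambda,\ln(1/\delta)\}$, if $X\sim\mu^m$ then $\|\widehat\mu_m-\mu\|_{TV}<\varepsilon$ with probability at least $1-\delta$. **Lower bounds.** There is a universal constant $c>0$ such that for all $\Lambda\ge2$, $0<\varepsilon<1/16$ and $0<\delta<1$: (i) for every $m$ and every estimator $\bar\mu:\mathbb N^m\to\Delta_{\mathbb N}$ there is $\mu\in\Delta_{\mathbb N}$ with $\|\mu[\varepsilon/18]\|_{1/2}\le\Lambda$ such that, if $\|\bar\mu(X)-\mu\|_{TV}<\varepsilon$ holds with probability at least $3/4$ for $X\sim\mu^m$, then $m\ge\frac{c}{\varepsilon^2}\Lambda$; (ii) for every $m$ and every estimator $\bar\nu:\mathbb N^m\to\Delta_{\mathbb N}$ there is $\nu\in\Delta_{\mathbb N}$ with $\|\nu[2\varepsilon\delta/9]\|_{1/2}\le\Lambda$ such that, if $\|\bar\nu(X)-\nu\|_{TV}<\varepsilon$ holds with probability at least $1-\delta$ for $X\sim\nu^m$, then $m\ge\frac{c}{\varepsilon^2}\ln(1/\delta)$. -/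

import Mathlib

open MeasureTheory
open scoped ENNReal

noncomputable section

namespace DiscreteEstimation

/-- The position (counted from `0`) of the point `i` when the points are listed by non-increasing
mass, ties being broken in favour of the smaller point. Every point of positive mass of a summable
`μ` has finite rank; points of mass zero may have rank `⊤` (exactly when the support is infinite). -/
def rank (μ : ℕ → ℝ≥0∞) (i : ℕ) : ℕ∞ :=
  Set.encard {j | μ i < μ j ∨ (μ j = μ i ∧ j < i)}

/-- The decreasing rearrangement of `μ`: `decr μ k` is the mass of the point of rank `k`
(counted from `0`; at most one point has rank `k`, so the sum has at most one nonzero term). -/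
def decr (μ : ℕ → ℝ≥0∞) (k : ℕ) : ℝ≥0∞ :=
  ∑' i, Set.indicator {i | rank μ i = k} μ i

/-- The least `t` such that the masses of `μ` other than the `t` largest ones sum to less
than `η`. -/
def truncIndex (μ : ℕ → ℝ≥0∞) (η : ℝ) : ℕ :=
  sInf {t : ℕ | ∑' k, decr μ (t + k) < ENNReal.ofReal η}

/-- The truncation `μ[η]`: `μ` restricted to its `truncIndex μ η` heaviest points. -/
def truncate (μ : ℕ → ℝ≥0∞) (η : ℝ) : ℕ → ℝ≥0∞ :=
  Set.indicator {i | rank μ i < truncIndex μ η} μ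

/-- The half-norm `(∑ i, √(μ i)) ^ 2`, possibly infinite. -/
def halfNorm (μ : ℕ → ℝ≥0∞) : ℝ≥0∞ :=
  (∑' i, μ i ^ (1 / 2 : ℝ)) ^ 2

/-- The mass function of a distribution on `ℕ`, with real values. -/
def mass (μ : PMF ℕ) (i : ℕ) : ℝ := (μ i).toReal

/-- Total variation distance of two mass functions, as half the `ℓ¹` distance. -/
def tv (p q : ℕ → ℝ) : ℝ := (1 / 2) * ∑' i, |p i - q i|

/-- The mass function of the empirical measure (the maximum likelihood estimator) of a sample. -/
def empirical {m : ℕ} (X : Fin m → ℕ) (i : ℕ) : ℝ :=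
  (1 / (m : ℝ)) * ∑ t, if X t = i then (1 : ℝ) else 0

/-- The law of a sample of `m` independent draws from `μ`. -/
def sampleLaw (μ : PMF ℕ) (m : ℕ) : Measure (Fin m → ℕ) :=
  Measure.pi fun _ => μ.toMeasure

end DiscreteEstimation

end

open MeasureTheory
open scoped ENNReal

noncomputable section

namespace DiscreteEstimation

/-! ### Total variation, and laws of samples drawn from finitely supported distributions. -/

section Basic

/-! Upper bound. The truncation supplies a finite set `F` with `∑ √μ(i) ≤ √Λ` over `F` and mass less
than `2εδ/9` outside. The error splits into its part on `F` (`partialError`) and half the empirical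
plus true mass off `F` (`tv_empirical_le`). On `F`, each coordinate has mean absolute error at most
its standard deviation, hence at most `√(μ(i)/m)`, so the expected error is at most `√(Λ/m)/2`. One
draw changes it by at most `1/m`, so McDiarmid (`hasSubgaussianMGF_of_bounded_differences`) gives
tail `exp(-2ms²)`. Off `F`, Markov's inequality controls the empirical mass; this is why the
truncation level carries the factor `δ`.

Lower bound in `Λ`. Put mass `1 - 2ε` on a visible point and spread `2ε` evenly over `K ≈ Λ/(24ε)`
points, the `j`-th hidden uniformly among `N` candidates of block `j`. An estimator cannot locate
the hidden point of a block it has not sampled: its average mass on such points is at most `1/N`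
(`sum_unseen_mass_le`). Success therefore requires hitting many blocks (`one_le_of_tv_lt`), while
the expected number of hidden draws is only `2εm`. Averaging over positions bounds the success
probability by about `4mε/K`, of order `mε²/Λ`.

Lower bound in `ln(1/δ)`. Coins of bias `±ε` cannot both be within `ε` of one estimate, so an
estimator is a test between them, and the Bhattacharyya coefficient `(1-4ε²)^(m/2)` is at most `2√δ`
(`log_le_of_coin`). For `δ` near `1`, the hidden-support construction is used instead. -/

lemma summable_mass (p : PMF ℕ) : Summable (mass p) :=
  ENNReal.summable_toReal p.tsum_coe_ne_top

lemma tsum_mass (p : PMF ℕ) : ∑' i, mass p i = 1 := by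
  simp only [mass]
  rw [← ENNReal.tsum_toReal_eq (fun a => p.apply_ne_top a), p.tsum_coe, ENNReal.toReal_one]

lemma mass_nonneg (p : PMF ℕ) (i : ℕ) : 0 ≤ mass p i := ENNReal.toReal_nonneg

lemma tv_comm (p q : ℕ → ℝ) : tv p q = tv q p := by
  simp only [tv, abs_sub_comm]

/-- The total variation distance dominates the discrepancy on every event. -/
lemma sum_sub_le_tv (p q : PMF ℕ) (S : Finset ℕ) :
    ∑ i ∈ S, (mass p i - mass q i) ≤ tv (mass p) (mass q) := by
  have hd : Summable fun i => mass p i - mass q i := (summable_mass p).sub (summable_mass q)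
  have h0 : ∑' i, (mass p i - mass q i) = 0 := by
    rw [(summable_mass p).tsum_sub (summable_mass q), tsum_mass, tsum_mass, sub_self]
  set d : ℕ → ℝ := fun i => mass p i - mass q i with hd_def
  have hS : HasSum (fun i => if i ∈ S then d i else 0) (∑ i ∈ S, d i) := by
    have : HasSum (fun i => if i ∈ S then d i else 0) (∑ i ∈ S, if i ∈ S then d i else 0) :=
      hasSum_sum_of_ne_finset_zero (fun b hb => by simp [hb])
    rwa [Finset.sum_congr rfl (fun i hi => if_pos hi)] at this
  -- Since `d` has total `0`, twice its sum over `S` is the series of `±d`, positive on `S` and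
  -- negative off it, which `|d|` dominates termwise.
  have he : HasSum (fun i => 2 * (if i ∈ S then d i else 0) - d i) (2 * ∑ i ∈ S, d i - 0) :=
    (hS.mul_left 2).sub (h0 ▸ hd.hasSum)
  have hle : 2 * ∑ i ∈ S, d i - 0 ≤ ∑' i, |d i| := by
    rw [← he.tsum_eq]
    refine he.summable.tsum_le_tsum (fun i => ?_) hd.abs
    by_cases hi : i ∈ S
    · simp only [hi, if_true]; linarith [le_abs_self (d i)]
    · simp only [hi, if_false]; linarith [neg_abs_le (d i)]
  unfold tv
  linarith

lemma sum_mass_le_one (p : PMF ℕ) (S : Finset ℕ) : ∑ i ∈ S, mass p i ≤ 1 :=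
  tsum_mass p ▸ (summable_mass p).sum_le_tsum S (fun i _ => mass_nonneg p i)

/-- Lets the lower bounds control the full half-norm, so that the truncation level plays no role in
them. -/
lemma halfNorm_truncate_le (μ : ℕ → ℝ≥0∞) (η : ℝ) : halfNorm (truncate μ η) ≤ halfNorm μ := by
  unfold halfNorm truncate
  gcongr with i
  exact Set.indicator_le_self _ _ _

variable {A : Type*}

lemma map_apply_of_injective (p : PMF A) {φ : A → ℕ} (hφ : φ.Injective) (a : A) :
    p.map φ (φ a) = p a := by
  rw [PMF.map_apply, tsum_eq_single a]
  · simp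
  · intro b hb
    rw [if_neg]
    exact fun h => hb (hφ h.symm)

variable [Fintype A]

/-- The distribution on a finite alphabet with prescribed real weights. -/
def weightedPMF (w : A → ℝ) (h0 : ∀ a, 0 ≤ w a) (h1 : ∑ a, w a = 1) : PMF A :=
  PMF.ofFintype (fun a => ENNReal.ofReal (w a)) (by
    rw [← ENNReal.ofReal_sum_of_nonneg (fun a _ => h0 a), h1, ENNReal.ofReal_one])

lemma weightedPMF_apply (w : A → ℝ) (h0 h1) (a : A) :
    weightedPMF w h0 h1 a = ENNReal.ofReal (w a) := rfl

lemma mass_map_weightedPMF (w : A → ℝ) (h0 h1) {φ : A → ℕ} (hφ : φ.Injective) (a : A) :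
    mass ((weightedPMF w h0 h1).map φ) (φ a) = w a := by
  rw [mass, map_apply_of_injective _ hφ, weightedPMF_apply, ENNReal.toReal_ofReal (h0 a)]

lemma halfNorm_map_weightedPMF (w : A → ℝ) (h0 h1) {φ : A → ℕ} (hφ : φ.Injective) :
    halfNorm ((weightedPMF w h0 h1).map φ) = ENNReal.ofReal ((∑ a, √(w a)) ^ 2) := by
  rw [ENNReal.ofReal_pow (Finset.sum_nonneg fun a _ => Real.sqrt_nonneg _),
    ENNReal.ofReal_sum_of_nonneg (fun a _ => Real.sqrt_nonneg _), halfNorm, ← hφ.tsum_eq]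
  · rw [tsum_fintype]
    congr 1
    refine Finset.sum_congr rfl fun a _ => ?_
    rw [map_apply_of_injective _ hφ, weightedPMF_apply,
      ENNReal.ofReal_rpow_of_nonneg (h0 a) (by norm_num), Real.sqrt_eq_rpow]
  · intro i hi
    have : (weightedPMF w h0 h1).map φ i ≠ 0 := by
      intro h
      rw [Function.mem_support, h] at hi
      exact hi (ENNReal.zero_rpow_of_pos (by norm_num))
    have := (PMF.mem_support_iff _ _).2 this
    rw [PMF.support_map] at this
    exact Set.image_subset_range _ _ this

/-- The law of a sample from an injective image of a finite distribution, as a finite sum over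
the latent samples. -/
lemma sampleLaw_map_weightedPMF (w : A → ℝ) (h0 h1) (φ : A → ℕ) (m : ℕ)
    (E : Set (Fin m → ℕ)) :
    (sampleLaw ((weightedPMF w h0 h1).map φ) m).real E =
      ∑ J : Fin m → A, (∏ t, w (J t)) * E.indicator 1 (fun t => φ (J t)) := by
  classical
  let _ : MeasurableSpace A := ⊤
  have : DiscreteMeasurableSpace A := ⟨fun _ => trivial⟩
  have hφ : Measurable φ := measurable_of_countable φ
  have hmap : sampleLaw ((weightedPMF w h0 h1).map φ) m =
      (Measure.pi fun _ : Fin m => (weightedPMF w h0 h1).toMeasure).map (fun J t => φ (J t)) := by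
    rw [Measure.pi_map_pi (fun _ => hφ.aemeasurable)]
    simp only [sampleLaw, PMF.toMeasure_map (hf := hφ)]
  rw [hmap, map_measureReal_apply (measurable_of_countable _) (Set.to_countable E).measurableSet]
  set S : Finset (Fin m → A) := Finset.univ.filter fun J => (fun t => φ (J t)) ∈ E with hS
  have hpre : (fun (J : Fin m → A) t => φ (J t)) ⁻¹' E = (S : Set (Fin m → A)) := by
    ext J; simp [hS]
  rw [hpre, ← sum_measureReal_singleton, hS, Finset.sum_filter]
  refine Finset.sum_congr rfl fun J _ => ?_
  by_cases hJ : (fun t => φ (J t)) ∈ E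
  · rw [if_pos hJ, Set.indicator_of_mem hJ, Measure.real, Measure.pi_singleton,
      ENNReal.toReal_prod, Pi.one_apply, mul_one]
    refine Finset.prod_congr rfl fun t _ => ?_
    rw [PMF.toMeasure_apply_singleton _ _ (measurableSet_singleton _), weightedPMF_apply,
      ENNReal.toReal_ofReal (h0 _)]
  · rw [if_neg hJ, Set.indicator_of_notMem hJ, mul_zero]

lemma sum_prod_eq_pow (w : A → ℝ) (m : ℕ) :
    ∑ J : Fin m → A, ∏ t, w (J t) = (∑ a, w a) ^ m := by
  classical
  rw [← Fintype.prod_sum (fun (_ : Fin m) a => w a)]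
  simp

lemma sum_prod_mul_apply (w : A → ℝ) (h1 : ∑ a, w a = 1) {m : ℕ} (g : A → ℝ) (t : Fin m) :
    ∑ J : Fin m → A, (∏ s, w (J s)) * g (J t) = ∑ a, w a * g a := by
  classical
  have h : ∀ J : Fin m → A, (∏ s, w (J s)) * g (J t) =
      ∏ s, (w (J s) * if s = t then g (J s) else 1) := by
    intro J
    rw [Finset.prod_mul_distrib, Finset.prod_ite_eq' Finset.univ t (fun s => g (J s))]
    simp
  simp only [h]
  rw [← Fintype.prod_sum (fun (s : Fin m) a => w a * if s = t then g a else 1),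
    Finset.prod_eq_single t]
  · simp
  · intro s _ hs
    simp [hs, h1]
  · simp

end Basic

/-! ### Lower bound in `Λ`: hidden supports. -/

/-- Resampling one coordinate of a uniform point of `Fin K → Fin N`. -/
lemma sum_apply_of_update_invariant {K N : ℕ} (j : Fin K) (g : (Fin K → Fin N) → Fin N → ℝ)
    (hg : ∀ x y, g (Function.update x j y) = g x) :
    (N : ℝ) * ∑ x, g x (x j) = ∑ x, ∑ y, g x y := by
  have h1 : ∑ x, ∑ y, g x y = ∑ z : (Fin K → Fin N) × Fin N, g z.1 z.2 :=
    (Fintype.sum_prod_type' g).symm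
  have h2 : ∑ z : (Fin K → Fin N) × Fin N, g z.1 z.2 =
      ∑ z : (Fin K → Fin N) × Fin N, g z.1 (z.1 j) := by
    -- Swapping `x j` with the spare value `y` is an involution under which `g` keeps its first
    -- argument up to coordinate `j`.
    refine Finset.sum_nbij' (fun z => (Function.update z.1 j z.2, z.1 j))
      (fun z => (Function.update z.1 j z.2, z.1 j)) (by simp) (by simp) (by simp) (by simp) ?_
    rintro ⟨x, y⟩ -
    simp [hg]
  rw [h1, h2, Fintype.sum_prod_type, Finset.mul_sum]
  simp

/-- The embedding of the latent alphabet: one visible point, and one hidden point per block. -/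
def hiddenEmb {K N : ℕ} (x : Fin K → Fin N) : Option (Fin K) → ℕ
  | none => 0
  | some j => Nat.pair j (x j) + 1

lemma hiddenEmb_injective {K N : ℕ} (x : Fin K → Fin N) : (hiddenEmb x).Injective := by
  rintro (_ | a) (_ | b) h
  · rfl
  · simp [hiddenEmb] at h
  · simp [hiddenEmb] at h
  · simp only [hiddenEmb, Nat.add_right_cancel_iff, Nat.pair_eq_pair] at h
    rw [Fin.ext h.1]

/-- Weight `1 - β` on the visible point, the rest spread evenly over the hidden points. -/
def hiddenWeight (K : ℕ) (β : ℝ) : Option (Fin K) → ℝ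
  | none => 1 - β
  | some _ => β / K

lemma hiddenWeight_nonneg {K : ℕ} {β : ℝ} (h0 : 0 ≤ β) (h1 : β ≤ 1) (a : Option (Fin K)) :
    0 ≤ hiddenWeight K β a := by
  cases a
  · simp [hiddenWeight, h1]
  · simp only [hiddenWeight]; positivity

lemma sum_hiddenWeight {K : ℕ} (hK : 0 < K) (β : ℝ) : ∑ a, hiddenWeight K β a = 1 := by
  have : (K : ℝ) ≠ 0 := by positivity
  simp only [Fintype.sum_option, hiddenWeight, Finset.sum_const, Finset.card_univ,
    Fintype.card_fin, nsmul_eq_mul]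
  field_simp
  ring

lemma sum_sqrt_hiddenWeight_sq_le {K : ℕ} {β Λ : ℝ} (h0 : 0 ≤ β)
    (hΛ : 2 ≤ Λ) (hK : K * β ≤ Λ / 12) :
    (∑ a, √(hiddenWeight K β a)) ^ 2 ≤ Λ := by
  have hs : ∑ a, √(hiddenWeight K β a) = √(1 - β) + √(K * β) := by
    simp only [Fintype.sum_option, hiddenWeight, Finset.sum_const, Finset.card_univ,
      Fintype.card_fin, nsmul_eq_mul]
    congr 1
    rcases Nat.eq_zero_or_pos K with rfl | hpos
    · simp
    · have hpos' : (0 : ℝ) < K := by positivity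
      rw [Real.sqrt_div h0, Real.sqrt_mul hpos'.le]
      field_simp
      rw [Real.sq_sqrt hpos'.le, mul_comm]
  have ha : √(1 - β) ≤ 1 := Real.sqrt_le_one.2 (by linarith)
  have ha0 := Real.sqrt_nonneg (1 - β)
  have hb0 := Real.sqrt_nonneg (K * β)
  have hb : √(K * β) ^ 2 ≤ Λ / 12 := by rwa [Real.sq_sqrt (by positivity)]
  rw [hs]
  -- With `b = √(Kβ)`, the square gives `2b ≤ 3b² + 1/3`, so `(1 + b)² ≤ 4/3 + 4b² ≤ 4/3 + Λ/3 ≤ Λ`,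
  -- the last step using `Λ ≥ 2`.
  nlinarith [sq_nonneg (3 * √(K * β) - 1)]

/-- The total mass of `p` on the hidden points of the blocks that `J` misses, averaged over
the positions of the hidden points, when `p` only depends on the blocks that `J` hits. -/
lemma sum_unseen_mass_le {K N m : ℕ} (J : Fin m → Option (Fin K))
    (est : (Fin m → ℕ) → PMF ℕ) :
    (N : ℝ) * ∑ x : Fin K → Fin N, ∑ j ∈ Finset.univ.filter (fun j => ∀ t, J t ≠ some j),
      mass (est fun t => hiddenEmb x (J t)) (hiddenEmb x (some j)) ≤ (N : ℝ) ^ K := by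
  set U := Finset.univ.filter (fun j => ∀ t, J t ≠ some j) with hU
  set q : (Fin K → Fin N) → PMF ℕ := fun x => est fun t => hiddenEmb x (J t) with hq
  have hres : ∀ j ∈ U, (N : ℝ) * ∑ x : Fin K → Fin N, mass (q x) (Nat.pair j (x j) + 1) =
      ∑ x : Fin K → Fin N, ∑ y : Fin N, mass (q x) (Nat.pair j y + 1) := by
    intro j hj
    refine sum_apply_of_update_invariant j (fun x y => mass (q x) (Nat.pair j y + 1)) ?_
    intro x y
    have : q (Function.update x j y) = q x := by
      simp only [hq]
      congr 1
      funext t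
      have hjt := (Finset.mem_filter.1 hj).2 t
      cases h : J t with
      | none => rfl
      | some i =>
        have : i ≠ j := fun hij => hjt (by rw [h, hij])
        simp [hiddenEmb, Function.update_of_ne this]
    simp only [this]
  rw [Finset.sum_comm, Finset.mul_sum]
  calc ∑ j ∈ U, (N : ℝ) * ∑ x : Fin K → Fin N, mass (q x) (hiddenEmb x (some j))
      = ∑ j ∈ U, ∑ x : Fin K → Fin N, ∑ y : Fin N, mass (q x) (Nat.pair j y + 1) :=
        Finset.sum_congr rfl hres
    _ = ∑ x : Fin K → Fin N, ∑ j ∈ U, ∑ y : Fin N, mass (q x) (Nat.pair j y + 1) :=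
        Finset.sum_comm
    _ ≤ ∑ x : Fin K → Fin N, (1 : ℝ) := by
        refine Finset.sum_le_sum fun x _ => ?_
        rw [← Finset.sum_product']
        have hinj : Set.InjOn (fun z : Fin K × Fin N => Nat.pair z.1 z.2 + 1)
            (U ×ˢ (Finset.univ : Finset (Fin N)) : Finset (Fin K × Fin N)) := by
          rintro ⟨a, b⟩ - ⟨c, d⟩ - h
          simp only [Nat.add_right_cancel_iff, Nat.pair_eq_pair] at h
          exact Prod.ext (Fin.ext h.1) (Fin.ext h.2)
        rw [← Finset.sum_image (f := mass (q x)) hinj]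
        exact sum_mass_le_one _ _
    _ = (N : ℝ) ^ K := by simp

/-- Success forces the estimator to put mass on the hidden points of unseen blocks. -/
lemma one_le_of_tv_lt {K N m : ℕ} (hK : 0 < K) {ε : ℝ} (hε : 0 < ε)
    (x : Fin K → Fin N) (J : Fin m → Option (Fin K)) (p ν : PMF ℕ)
    (hν : ∀ j, mass ν (hiddenEmb x (some j)) = 2 * ε / K) (h : tv (mass p) (mass ν) < ε) :
    1 ≤ 2 / K * ∑ t, (if J t = none then (0 : ℝ) else 1) +
      1 / ε * ∑ j ∈ Finset.univ.filter (fun j => ∀ t, J t ≠ some j),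
        mass p (hiddenEmb x (some j)) := by
  classical
  set U := Finset.univ.filter (fun j => ∀ t, J t ≠ some j) with hU
  have hKr : (0 : ℝ) < K := by positivity
  have hcard : (K : ℝ) ≤ U.card + ∑ t, (if J t = none then (0 : ℝ) else 1) := by
    have h1 : (Uᶜ).card ≤ (Finset.univ.filter fun t => J t ≠ none).card := by
      -- Each hit block is charged to a hidden draw, so at most that many blocks are hit; the
      -- default of `getD` is never taken on this filter.
      have : Uᶜ ⊆ (Finset.univ.filter fun t => J t ≠ none).image
          (fun t => (J t).getD ⟨0, hK⟩) := by
        intro j hj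
        simp only [hU, Finset.mem_compl, Finset.mem_filter, Finset.mem_univ, true_and, not_forall,
          not_not] at hj
        obtain ⟨t, ht⟩ := hj
        exact Finset.mem_image.2 ⟨t, by simp [ht], by simp [ht]⟩
      exact (Finset.card_le_card this).trans Finset.card_image_le
    have h2 : U.card + (Uᶜ).card = K := by simp
    have h3 : ∑ t, (if J t = none then (0 : ℝ) else 1) =
        (Finset.univ.filter fun t => J t ≠ none).card := by
      rw [Finset.card_filter]
      push_cast
      exact Finset.sum_congr rfl fun t _ => by by_cases h : J t = none <;> simp [h]
    rw [h3]
    exact_mod_cast (by omega :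
      K ≤ U.card + (Finset.univ.filter fun t => J t ≠ none).card)
  have htv := sum_sub_le_tv ν p (U.image fun j => hiddenEmb x (some j))
  rw [tv_comm, Finset.sum_image (fun a _ b _ hab =>
    Option.some_injective _ (hiddenEmb_injective x hab)), Finset.sum_sub_distrib] at htv
  simp only [hν, Finset.sum_const, nsmul_eq_mul] at htv
  set S := ∑ j ∈ U, mass p (hiddenEmb x (some j))
  set n := ∑ t, (if J t = none then (0 : ℝ) else 1)
  have h1 : (K - n) * (2 * ε / K) ≤ U.card * (2 * ε / K) := by
    gcongr
    linarith
  have h2 : (K - n) * (2 * ε / K) = 2 * ε - 2 / K * n * ε := by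
    field_simp
  have h3 : ε < 2 / K * n * ε + S := by linarith
  have h4 : 1 < (2 / K * n * ε + S) / ε := by rwa [lt_div_iff₀ hε, one_mul]
  have h5 : (2 / K * n * ε + S) / ε = 2 / K * n + 1 / ε * S := by field_simp
  linarith

/-- Every estimator fails on some distribution with hidden support unless the sample is large. -/
lemma exists_success_le_of_hidden {K m : ℕ} (hK : 0 < K) {ε τ : ℝ} (hε : 0 < ε) (hε1 : ε ≤ 1 / 2)
    (hτ : 0 < τ) (est : (Fin m → ℕ) → PMF ℕ) :
    ∃ μ : PMF ℕ,
      halfNorm μ = ENNReal.ofReal ((∑ a, √(hiddenWeight K (2 * ε) a)) ^ 2) ∧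
      (sampleLaw μ m).real {X | tv (mass (est X)) (mass μ) < ε} ≤ 4 * m * ε / K + τ := by
  classical
  -- Blocks this large make the guessing term `1/(Nε)` smaller than `τ`.
  obtain ⟨N, hN⟩ := exists_nat_gt (1 / (τ * ε))
  have hNpos : (0 : ℝ) < N := lt_trans (by positivity) hN
  have : NeZero N := ⟨by rintro rfl; simp at hNpos⟩
  have hKr : (0 : ℝ) < K := by positivity
  set w := hiddenWeight K (2 * ε) with hw
  have w0 : ∀ a, 0 ≤ w a := hiddenWeight_nonneg (by linarith) (by linarith)
  have w1 : ∑ a, w a = 1 := sum_hiddenWeight hK _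
  let ν : (Fin K → Fin N) → PMF ℕ := fun x => (weightedPMF w w0 w1).map (hiddenEmb x)
  have hνj : ∀ x j, mass (ν x) (hiddenEmb x (some j)) = 2 * ε / K := fun x j =>
    mass_map_weightedPMF w w0 w1 (hiddenEmb_injective x) (some j)
  let P : (Fin K → Fin N) → ℝ := fun x =>
    (sampleLaw (ν x) m).real {X | tv (mass (est X)) (mass (ν x)) < ε}
  let c : (Fin m → Option (Fin K)) → ℝ := fun J => ∑ t, (if J t = none then (0 : ℝ) else 1)
  let S : (Fin m → Option (Fin K)) → (Fin K → Fin N) → ℝ := fun J x =>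
    ∑ j ∈ Finset.univ.filter (fun j => ∀ t, J t ≠ some j),
      mass (est fun t => hiddenEmb x (J t)) (hiddenEmb x (some j))
  have hS0 : ∀ J x, 0 ≤ S J x := fun J x => Finset.sum_nonneg fun j _ => mass_nonneg _ _
  have hc0 : ∀ J, 0 ≤ c J := fun J => Finset.sum_nonneg fun t _ => by split_ifs <;> norm_num
  have hprod0 : ∀ J : Fin m → Option (Fin K), 0 ≤ ∏ t, w (J t) :=
    fun J => Finset.prod_nonneg fun t _ => w0 _
  have hP : ∀ x, P x ≤ ∑ J : Fin m → Option (Fin K),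
      (∏ t, w (J t)) * (2 / K * c J + 1 / ε * S J x) := by
    intro x
    simp only [P, ν, sampleLaw_map_weightedPMF]
    refine Finset.sum_le_sum fun J _ => mul_le_mul_of_nonneg_left ?_ (hprod0 J)
    have hnn : 0 ≤ 2 / K * c J + 1 / ε * S J x := by
      have := hS0 J x
      have := hc0 J
      positivity
    -- A Markov-type bound: the indicator of success is at most a nonnegative quantity that is at
    -- least `1` on success.
    refine Set.indicator_apply_le' (fun hJ => ?_) (fun _ => hnn)
    exact one_le_of_tv_lt hK hε x J _ _ (hνj x) hJ
  have hc : ∑ J : Fin m → Option (Fin K), (∏ t, w (J t)) * c J = m * (2 * ε) := by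
    simp only [c, Finset.mul_sum]
    rw [Finset.sum_comm]
    simp only [sum_prod_mul_apply w w1 (fun a => if a = none then (0 : ℝ) else 1)]
    simp [Fintype.sum_option, hw, hiddenWeight]
    field_simp
    simp
  have htot : ∑ J : Fin m → Option (Fin K), ∏ t, w (J t) = 1 := by
    rw [sum_prod_eq_pow, w1, one_pow]
  have havg : ∑ x, P x ≤ ∑ _x : Fin K → Fin N, (4 * m * ε / K + τ) := by
    calc ∑ x, P x ≤ ∑ x : Fin K → Fin N, ∑ J : Fin m → Option (Fin K),
          (∏ t, w (J t)) * (2 / K * c J + 1 / ε * S J x) := Finset.sum_le_sum fun x _ => hP x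
      _ = ∑ J : Fin m → Option (Fin K), (∏ t, w (J t)) *
          ((N : ℝ) ^ K * (2 / K * c J) + 1 / ε * ∑ x, S J x) := by
          rw [Finset.sum_comm]
          refine Finset.sum_congr rfl fun J _ => ?_
          rw [← Finset.mul_sum, Finset.sum_add_distrib, Finset.mul_sum Finset.univ (S J) (1 / ε)]
          simp
      _ ≤ ∑ J : Fin m → Option (Fin K), (∏ t, w (J t)) *
          ((N : ℝ) ^ K * (2 / K * c J) + 1 / ε * ((N : ℝ) ^ K / N)) := by
          refine Finset.sum_le_sum fun J _ => mul_le_mul_of_nonneg_left ?_ (hprod0 J)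
          gcongr
          rw [le_div_iff₀ hNpos, mul_comm]
          exact sum_unseen_mass_le J est
      _ = (N : ℝ) ^ K * (2 / K * (m * (2 * ε)) + 1 / (N * ε)) := by
          rw [← hc]
          simp only [mul_add, Finset.sum_add_distrib]
          rw [← Finset.sum_mul, htot, Finset.mul_sum, Finset.mul_sum]
          congr 1
          · refine Finset.sum_congr rfl fun J _ => by ring
          · field_simp
      _ ≤ (N : ℝ) ^ K * (4 * m * ε / K + τ) := by
          gcongr
          · exact le_of_eq (by ring)
          · rw [div_lt_iff₀ (by positivity)] at hN
            rw [div_le_iff₀ (by positivity)]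
            linarith
      _ = ∑ _x : Fin K → Fin N, (4 * m * ε / K + τ) := by simp [mul_add]
  obtain ⟨x, -, hx⟩ := Finset.exists_le_of_sum_le (Finset.univ_nonempty) havg
  exact ⟨ν x, halfNorm_map_weightedPMF w w0 w1 (hiddenEmb_injective x), hx⟩

/-- The number of hidden points is chosen proportional to `Λ / ε`. -/
lemma exists_success_le {m : ℕ} {Λ ε τ : ℝ} (hΛ : 2 ≤ Λ) (hε : 0 < ε) (hε1 : ε < 1 / 16)
    (hτ : 0 < τ) (est : (Fin m → ℕ) → PMF ℕ) :
    ∃ μ : PMF ℕ, halfNorm μ ≤ ENNReal.ofReal Λ ∧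
      (sampleLaw μ m).real {X | tv (mass (est X)) (mass μ) < ε} ≤ 192 * m * ε ^ 2 / Λ + τ := by
  have hΛε : 1 ≤ Λ / (24 * ε) := by rw [le_div_iff₀ (by positivity)]; linarith
  set K := ⌊Λ / (24 * ε)⌋₊ with hKdef
  have hK : 0 < K := Nat.floor_pos.2 hΛε
  have hK1 : (1 : ℝ) ≤ K := by exact_mod_cast hK
  have hKle : (K : ℝ) ≤ Λ / (24 * ε) := Nat.floor_le (by linarith)
  have hKge : Λ / (24 * ε) < K + 1 := Nat.lt_floor_add_one _
  obtain ⟨μ, h1, h2⟩ := exists_success_le_of_hidden hK hε (by linarith) hτ est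
  refine ⟨μ, ?_, h2.trans ?_⟩
  · rw [h1]
    refine ENNReal.ofReal_le_ofReal (sum_sqrt_hiddenWeight_sq_le (by linarith) hΛ ?_)
    rw [le_div_iff₀ (by positivity)] at hKle
    linarith
  · refine add_le_add ?_ le_rfl
    rw [div_le_div_iff₀ (by positivity) (by positivity)]
    -- As `K ≥ 1`, rounding down loses at most a factor `2`.
    have : Λ ≤ 48 * ε * K := by
      rw [div_lt_iff₀ (by positivity)] at hKge
      nlinarith
    calc 4 * m * ε * Λ ≤ 4 * m * ε * (48 * ε * K) := by gcongr
      _ = 192 * m * ε ^ 2 * K := by ring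

/-! ### Lower bound in `ln(1/δ)`: testing two coins. -/

/-- The Bhattacharyya coefficient is controlled by the error probabilities of any test. -/
lemma sum_sqrt_mul_sqrt_le_of_disjoint {Ω : Type*} [Fintype Ω] [DecidableEq Ω] {f g : Ω → ℝ}
    (hf : ∀ x, 0 ≤ f x) (hg : ∀ x, 0 ≤ g x) (hf1 : ∑ x, f x = 1) (hg1 : ∑ x, g x = 1)
    {S T : Finset Ω} (hST : Disjoint S T) :
    ∑ x, √(f x) * √(g x) ≤ √(∑ x ∈ Sᶜ, f x) + √(∑ x ∈ Tᶜ, g x) := by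
  have hcs : ∀ R : Finset Ω, ∑ x ∈ R, √(f x) * √(g x) ≤ √(∑ x ∈ R, f x) * √(∑ x ∈ R, g x) :=
    fun R => Real.sum_sqrt_mul_sqrt_le R hf hg
  have hle : ∀ (h : Ω → ℝ) (R : Finset Ω), (∀ x, 0 ≤ h x) → ∑ x, h x = 1 → √(∑ x ∈ R, h x) ≤ 1 :=
    fun h R h0 h1 => Real.sqrt_le_one.2
      (h1 ▸ Finset.sum_le_sum_of_subset_of_nonneg (Finset.subset_univ R) fun x _ _ => h0 x)
  have hsub : S ⊆ Tᶜ := fun x hx => Finset.mem_compl.2 (Finset.disjoint_left.1 hST hx)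
  rw [← Finset.sum_compl_add_sum S]
  refine add_le_add ((hcs _).trans ?_) ((hcs _).trans ?_)
  · exact mul_le_of_le_one_right (Real.sqrt_nonneg _) (hle g _ hg hg1)
  · refine (mul_le_of_le_one_left (Real.sqrt_nonneg _) (hle f _ hf hf1)).trans ?_
    exact Real.sqrt_le_sqrt (Finset.sum_le_sum_of_subset_of_nonneg hsub fun x _ _ => hg x)

/-- The weights of a coin with bias `s`. -/
def coinWeight (s : ℝ) (b : Bool) : ℝ := if b then 1 / 2 + s else 1 / 2 - s

lemma coinWeight_nonneg {s : ℝ} (hs : |s| ≤ 1 / 2) (b : Bool) : 0 ≤ coinWeight s b := by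
  rw [abs_le] at hs
  cases b <;> simp only [coinWeight, if_true, Bool.false_eq_true, if_false] <;> linarith

lemma sum_coinWeight (s : ℝ) : ∑ b, coinWeight s b = 1 := by
  simp [coinWeight]; norm_num

/-- The distribution on `{0, 1}` with bias `s`. -/
def coin (s : ℝ) (hs : |s| ≤ 1 / 2) : PMF ℕ :=
  (weightedPMF (coinWeight s) (coinWeight_nonneg hs) (sum_coinWeight s)).map Bool.toNat

lemma toNat_injective : Bool.toNat.Injective := by decide

lemma mass_coin_one {s : ℝ} (hs : |s| ≤ 1 / 2) : mass (coin s hs) 1 = 1 / 2 + s :=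
  mass_map_weightedPMF _ (coinWeight_nonneg hs) (sum_coinWeight s) toNat_injective true

lemma halfNorm_coin_le {s : ℝ} (hs : |s| ≤ 1 / 2) : halfNorm (coin s hs) ≤ ENNReal.ofReal 2 := by
  rw [coin, halfNorm_map_weightedPMF _ _ _ toNat_injective]
  refine ENNReal.ofReal_le_ofReal ?_
  have h1 := Real.sq_sqrt (coinWeight_nonneg hs true)
  have h2 := Real.sq_sqrt (coinWeight_nonneg hs false)
  have h3 := sum_coinWeight s
  simp only [Fintype.sum_bool] at h3 ⊢
  nlinarith [sq_nonneg (√(coinWeight s true) - √(coinWeight s false))]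

/-- An estimator that is accurate with probability `1 - δ` on both of two coins with opposite
biases needs a sample whose size is logarithmic in `1 / δ`. -/
lemma log_le_of_coin {m : ℕ} {ε δ : ℝ} (hε : 0 < ε) (hs : |ε| ≤ 1 / 2) (hs' : |-ε| ≤ 1 / 2)
    (hε1 : ε < 1 / 16) (hδ : 0 < δ) (hδ1 : δ ≤ 1 / 16) (est : (Fin m → ℕ) → PMF ℕ)
    (h1 : 1 - δ ≤ (sampleLaw (coin ε hs) m).real {X | tv (mass (est X)) (mass (coin ε hs)) < ε})
    (h2 : 1 - δ ≤
      (sampleLaw (coin (-ε) hs') m).real {X | tv (mass (est X)) (mass (coin (-ε) hs')) < ε}) :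
    Real.log (1 / δ) ≤ 16 * ε ^ 2 * m := by
  classical
  set f : (Fin m → Bool) → ℝ := fun J => ∏ t, coinWeight ε (J t) with hf
  set g : (Fin m → Bool) → ℝ := fun J => ∏ t, coinWeight (-ε) (J t) with hg
  set S : Finset (Fin m → Bool) := Finset.univ.filter fun J =>
    tv (mass (est fun t => (J t).toNat)) (mass (coin ε hs)) < ε with hS
  set T : Finset (Fin m → Bool) := Finset.univ.filter fun J =>
    tv (mass (est fun t => (J t).toNat)) (mass (coin (-ε) hs')) < ε with hT
  have hf0 : ∀ J, 0 ≤ f J := fun J => Finset.prod_nonneg fun t _ => coinWeight_nonneg hs _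
  have hg0 : ∀ J, 0 ≤ g J := fun J => Finset.prod_nonneg fun t _ => coinWeight_nonneg hs' _
  have hf1 : ∑ J, f J = 1 := by rw [hf, sum_prod_eq_pow, sum_coinWeight, one_pow]
  have hg1 : ∑ J, g J = 1 := by rw [hg, sum_prod_eq_pow, sum_coinWeight, one_pow]
  -- The two coins give masses to `1` that differ by `2ε`, so no estimate is within `ε` of both.
  have hST : Disjoint S T := by
    refine Finset.disjoint_left.2 fun J hJ hJ' => ?_
    have a1 := (Finset.mem_filter.1 hJ).2
    have a2 := (Finset.mem_filter.1 hJ').2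
    have b1 := sum_sub_le_tv (coin ε hs) (est fun t => (J t).toNat) {1}
    have b2 := sum_sub_le_tv (est fun t => (J t).toNat) (coin (-ε) hs') {1}
    rw [tv_comm] at b1
    simp only [Finset.sum_singleton, mass_coin_one] at b1 b2
    linarith
  have hSc : ∑ J ∈ Sᶜ, f J ≤ δ := by
    have : (sampleLaw (coin ε hs) m).real {X | tv (mass (est X)) (mass (coin ε hs)) < ε} =
        ∑ J ∈ S, f J := by
      rw [coin, sampleLaw_map_weightedPMF, hS, Finset.sum_filter]
      refine Finset.sum_congr rfl fun J _ => ?_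
      simp only [Set.indicator_apply, Set.mem_ofPred_eq, Pi.one_apply, mul_ite, mul_one, mul_zero]
      rfl
    have h3 := Finset.sum_compl_add_sum S f
    linarith
  have hTc : ∑ J ∈ Tᶜ, g J ≤ δ := by
    have : (sampleLaw (coin (-ε) hs') m).real
        {X | tv (mass (est X)) (mass (coin (-ε) hs')) < ε} = ∑ J ∈ T, g J := by
      rw [coin, sampleLaw_map_weightedPMF, hT, Finset.sum_filter]
      refine Finset.sum_congr rfl fun J _ => ?_
      simp only [Set.indicator_apply, Set.mem_ofPred_eq, Pi.one_apply, mul_ite, mul_one, mul_zero]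
      rfl
    have h3 := Finset.sum_compl_add_sum T g
    linarith
  have hnn : 0 ≤ 1 - 4 * ε ^ 2 := by nlinarith
  have hBC : ∑ J, √(f J) * √(g J) = √(1 - 4 * ε ^ 2) ^ m := by
    have : ∀ J : Fin m → Bool, √(f J) * √(g J) =
        ∏ t, √(coinWeight ε (J t)) * √(coinWeight (-ε) (J t)) := by
      intro J
      rw [Finset.prod_mul_distrib, Real.sqrt_prod _ fun t _ => coinWeight_nonneg hs _,
        Real.sqrt_prod _ fun t _ => coinWeight_nonneg hs' _]
    simp only [this]
    rw [sum_prod_eq_pow (fun b => √(coinWeight ε b) * √(coinWeight (-ε) b))]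
    congr 1
    simp only [Fintype.sum_bool, ← Real.sqrt_mul (coinWeight_nonneg hs _)]
    have e1 : coinWeight ε true * coinWeight (-ε) true = (1 - 4 * ε ^ 2) / 2 ^ 2 := by
      simp [coinWeight]; ring
    have e2 : coinWeight ε false * coinWeight (-ε) false = (1 - 4 * ε ^ 2) / 2 ^ 2 := by
      simp [coinWeight]; ring
    rw [e1, e2, Real.sqrt_div hnn, Real.sqrt_sq (by norm_num)]
    ring
  have hmain := sum_sqrt_mul_sqrt_le_of_disjoint hf0 hg0 hf1 hg1 hST
  rw [hBC] at hmain
  have hle : √(1 - 4 * ε ^ 2) ^ m ≤ 2 * √δ := by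
    linarith [Real.sqrt_le_sqrt hSc, Real.sqrt_le_sqrt hTc]
  have hpow : (1 - 4 * ε ^ 2) ^ m ≤ 4 * δ := by
    calc (1 - 4 * ε ^ 2) ^ m = (√(1 - 4 * ε ^ 2) ^ m) ^ 2 := by
          rw [← pow_mul, mul_comm m 2, pow_mul, Real.sq_sqrt hnn]
      _ ≤ (2 * √δ) ^ 2 := by gcongr
      _ = 4 * δ := by rw [mul_pow, Real.sq_sqrt hδ.le]; norm_num
  -- With `y = ε²`, `exp(-8y) ≤ 1/(1 + 8y)`, and `(1 + 8y)(1 - 4y) ≥ 1` for `y ≤ 1/8`.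
  have hexp : Real.exp (-(8 * ε ^ 2)) ≤ 1 - 4 * ε ^ 2 := by
    rw [Real.exp_neg]
    have hy := Real.add_one_le_exp (8 * ε ^ 2)
    refine (inv_anti₀ (by positivity) hy).trans ?_
    rw [inv_le_iff_one_le_mul₀ (by positivity)]
    have : ε ^ 2 ≤ 1 / 16 := by nlinarith
    nlinarith [sq_nonneg ε]
  -- Squaring absorbs the constant: `(4δ)² ≤ δ` because `δ ≤ 1/16`.
  have hfin : Real.exp (-(16 * ε ^ 2 * m)) ≤ δ := by
    calc Real.exp (-(16 * ε ^ 2 * m)) = (Real.exp (-(8 * ε ^ 2)) ^ m) ^ 2 := by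
          rw [← pow_mul, ← Real.exp_nat_mul]
          congr 1
          push_cast
          ring
      _ ≤ ((1 - 4 * ε ^ 2) ^ m) ^ 2 := by gcongr
      _ ≤ (4 * δ) ^ 2 := by gcongr
      _ ≤ δ := by nlinarith
  rw [one_div, Real.log_inv]
  have := Real.log_le_log (Real.exp_pos _) hfin
  rw [Real.log_exp] at this
  linarith

/-! ### The two lower bounds with a common constant. -/

lemma exists_halfNorm_lower {m : ℕ} {Λ ε η : ℝ} (hΛ : 2 ≤ Λ) (hε : 0 < ε)
    (hε1 : ε < 1 / 16) (est : (Fin m → ℕ) → PMF ℕ) :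
    ∃ μ : PMF ℕ, halfNorm (truncate μ η) ≤ ENNReal.ofReal Λ ∧
      (3 / 4 ≤ (sampleLaw μ m).real {X | tv (mass (est X)) (mass μ) < ε} →
        1 / 3072 / ε ^ 2 * Λ ≤ (m : ℝ)) := by
  obtain ⟨μ, h1, h2⟩ := exists_success_le (τ := 1 / 4) hΛ hε hε1 (by norm_num) est
  refine ⟨μ, (halfNorm_truncate_le _ _).trans h1, fun h => ?_⟩
  have h3 : 1 / 2 ≤ 192 * m * ε ^ 2 / Λ := by linarith
  rw [le_div_iff₀ (by positivity)] at h3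
  rw [div_mul_eq_mul_div, div_le_iff₀ (by positivity)]
  linarith

/-- For `δ ≤ 1/16`, the witness is a coin on which the estimator fails, if the first one is such;
otherwise it is the second coin, where success forces the bound. For larger `δ`, `ln(1/δ) ≤ (1-δ)/δ
≤ 16(1-δ)`, and `exists_success_le` bounds `1-δ` by `192mε²`; hence the constant `3072 = 16 · 192`.
-/
lemma exists_log_lower {m : ℕ} {Λ ε δ η : ℝ} (hΛ : 2 ≤ Λ) (hε : 0 < ε)
    (hε1 : ε < 1 / 16) (hδ : 0 < δ) (hδ1 : δ < 1) (est : (Fin m → ℕ) → PMF ℕ) :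
    ∃ ν : PMF ℕ, halfNorm (truncate ν η) ≤ ENNReal.ofReal Λ ∧
      (1 - δ ≤ (sampleLaw ν m).real {X | tv (mass (est X)) (mass ν) < ε} →
        1 / 3072 / ε ^ 2 * Real.log (1 / δ) ≤ (m : ℝ)) := by
  rcases le_total δ (1 / 16) with hsmall | hlarge
  · have hs : |ε| ≤ 1 / 2 := by rw [abs_of_pos hε]; linarith
    have hs' : |-ε| ≤ 1 / 2 := by rwa [abs_neg]
    have hnorm : ∀ s (h : |s| ≤ 1 / 2),
        halfNorm (truncate (coin s h) η) ≤ ENNReal.ofReal Λ := fun s h =>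
      (halfNorm_truncate_le _ _).trans
        ((halfNorm_coin_le h).trans (ENNReal.ofReal_le_ofReal hΛ))
    by_cases h1 : 1 - δ ≤
        (sampleLaw (coin ε hs) m).real {X | tv (mass (est X)) (mass (coin ε hs)) < ε}
    · refine ⟨coin (-ε) hs', hnorm _ _, fun h2 => ?_⟩
      have := log_le_of_coin hε hs hs' hε1 hδ hsmall est h1 h2
      rw [div_mul_eq_mul_div, div_le_iff₀ (by positivity)]
      nlinarith [mul_nonneg (sq_nonneg ε) (Nat.cast_nonneg (α := ℝ) m)]
    · exact ⟨coin ε hs, hnorm _ _, fun h => absurd h h1⟩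
  · obtain ⟨μ, h1, h2⟩ := exists_success_le (τ := (1 - δ) / 2) hΛ hε hε1 (by linarith) est
    refine ⟨μ, (halfNorm_truncate_le _ _).trans h1, fun h => ?_⟩
    have h3 : (1 - δ) / 2 ≤ 192 * m * ε ^ 2 / Λ := by linarith
    rw [le_div_iff₀ (by positivity)] at h3
    have h4 : Real.log (1 / δ) ≤ 16 * (1 - δ) := by
      have ha := Real.log_le_sub_one_of_pos (show 0 < 1 / δ by positivity)
      have hb : 1 / δ - 1 = (1 - δ) / δ := by field_simp
      rw [hb] at ha
      refine ha.trans ?_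
      rw [div_le_iff₀ hδ]
      nlinarith
    rw [div_mul_eq_mul_div, div_le_iff₀ (by positivity)]
    nlinarith

/-! ### McDiarmid's inequality. -/

section BoundedDifferences

variable {α : Type*} [MeasurableSpace α]

lemma integral_pi_fin_succ (P : Measure α) [IsProbabilityMeasure P] {n : ℕ}
    {h : (Fin (n + 1) → α) → ℝ} (hh : Integrable h (Measure.pi fun _ => P)) :
    ∫ x, h x ∂(Measure.pi fun _ : Fin (n + 1) => P) =
      ∫ a, ∫ x, h (Fin.cons a x) ∂(Measure.pi fun _ : Fin n => P) ∂P := by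
  have hmp := (measurePreserving_piFinSuccAbove (fun _ : Fin (n + 1) => P) 0).symm
  have key : ∀ z : α × (Fin n → α),
      (MeasurableEquiv.piFinSuccAbove (fun _ : Fin (n + 1) => α) 0).symm z = Fin.cons z.1 z.2 := by
    intro z
    simp [MeasurableEquiv.piFinSuccAbove_symm_apply, Fin.insertNthEquiv]
  rw [← hmp.integral_comp']
  rw [← hmp.integrable_comp_emb (MeasurableEquiv.measurableEmbedding _)] at hh
  simp only [Function.comp_def, key] at hh ⊢
  exact integral_prod _ hh

variable [Countable α] [MeasurableSingletonClass α]

lemma integrable_of_abs_le {Ω : Type*} [MeasurableSpace Ω] [Countable Ω]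
    [MeasurableSingletonClass Ω] (P : Measure Ω) [IsProbabilityMeasure P] {h : Ω → ℝ} {B : ℝ}
    (hB : ∀ x, |h x| ≤ B) : Integrable h P :=
  Integrable.of_bound (measurable_of_countable h).aestronglyMeasurable B
    (Filter.Eventually.of_forall hB)

lemma abs_integral_le {Ω : Type*} [MeasurableSpace Ω] (P : Measure Ω) [IsProbabilityMeasure P]
    {h : Ω → ℝ} {B : ℝ} (hB : ∀ x, |h x| ≤ B) : |∫ x, h x ∂P| ≤ B := by
  have := norm_integral_le_of_norm_le_const (μ := P) (f := h) (Filter.Eventually.of_forall hB)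
  simpa using this

lemma integrable_exp_of_abs_le {Ω : Type*} [MeasurableSpace Ω] [Countable Ω]
    [MeasurableSingletonClass Ω] (P : Measure Ω) [IsProbabilityMeasure P] {h : Ω → ℝ} {B : ℝ}
    (hB : ∀ x, |h x| ≤ B) (t e : ℝ) : Integrable (fun x => Real.exp (t * (h x - e))) P :=
  ProbabilityTheory.integrable_exp_mul_of_mem_Icc (a := -B - e) (b := B - e)
    (measurable_of_countable _).aemeasurable (Filter.Eventually.of_forall fun x => by
      have := abs_le.1 (hB x)
      exact ⟨by linarith, by linarith⟩)

/-- **McDiarmid's inequality** on a countable space, in sub-Gaussian form. -/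
theorem hasSubgaussianMGF_of_bounded_differences (P : Measure α) [IsProbabilityMeasure P]
    (c B : ℝ) : ∀ (n : ℕ) (f : (Fin n → α) → ℝ), (∀ x, |f x| ≤ B) →
      (∀ x i y, |f (Function.update x i y) - f x| ≤ c) →
      ProbabilityTheory.HasSubgaussianMGF
        (fun x => f x - ∫ y, f y ∂(Measure.pi fun _ : Fin n => P)) (n * (‖c‖₊ / 2) ^ 2)
        (Measure.pi fun _ : Fin n => P) := by
  intro n
  induction n with
  | zero =>
    intro f _ _
    have : (fun x => f x - ∫ y, f y ∂(Measure.pi fun _ : Fin 0 => P)) = fun _ => 0 := by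
      funext x
      rw [Measure.pi_of_empty, integral_dirac, Subsingleton.elim x, sub_self]
    rw [this]
    simp
  | succ n ih =>
    intro f hB hc
    set π := Measure.pi fun _ : Fin n => P with hπ
    set F : α → (Fin n → α) → ℝ := fun a x => f (Fin.cons a x) with hF
    -- The deviation splits into `F a x - g a`, handled by induction for fixed `a`, and `g a - E g`,
    -- where `g` lies in an interval of length `c` and Hoeffding's lemma applies. The variance
    -- proxies add.
    set g : α → ℝ := fun a => ∫ x, F a x ∂π with hg
    have hFB : ∀ a x, |F a x| ≤ B := fun a x => hB _
    have hgB : ∀ a, |g a| ≤ B := fun a => abs_integral_le π (hFB a)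
    have hFc : ∀ a x i y, |F a (Function.update x i y) - F a x| ≤ c := by
      intro a x i y
      simp only [hF, Fin.cons_update]
      exact hc _ _ _
    have hgc : ∀ a b, g a - g b ≤ c := by
      intro a b
      simp only [hg]
      rw [← integral_sub (integrable_of_abs_le π (hFB a)) (integrable_of_abs_le π (hFB b))]
      refine (le_abs_self _).trans (abs_integral_le π fun x => ?_)
      have := hc (Fin.cons b x) 0 a
      rwa [Fin.update_cons_zero] at this
    have hmean : ∫ y, f y ∂(Measure.pi fun _ : Fin (n + 1) => P) = ∫ a, g a ∂P :=
      integral_pi_fin_succ P (integrable_of_abs_le _ hB)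
    have hbdd : BddBelow (Set.range g) := ⟨-B, by
      rintro _ ⟨a, rfl⟩
      exact (abs_le.1 (hgB a)).1⟩
    have : Nonempty α := P.nonempty_of_neZero
    have hHoeff := ProbabilityTheory.hasSubgaussianMGF_of_mem_Icc (μ := P) (X := g)
      (a := ⨅ a, g a) (b := (⨅ a, g a) + c) (measurable_of_countable g).aemeasurable
      (Filter.Eventually.of_forall fun a => ⟨ciInf_le hbdd a, by
        have : g a - c ≤ ⨅ a, g a := le_ciInf fun b => by linarith [hgc a b]
        linarith⟩)
    rw [add_sub_cancel_left] at hHoeff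
    refine ⟨fun t => integrable_exp_of_abs_le _ hB t _, fun t => ?_⟩
    set v : NNReal := (‖c‖₊ / 2) ^ 2 with hv
    unfold ProbabilityTheory.mgf
    rw [integral_pi_fin_succ P (integrable_exp_of_abs_le _ hB t _), hmean]
    calc ∫ a, ∫ x, Real.exp (t * (f (Fin.cons a x) - ∫ a, g a ∂P)) ∂π ∂P
        = ∫ a, (∫ x, Real.exp (t * (F a x - g a)) ∂π) *
            Real.exp (t * (g a - ∫ a, g a ∂P)) ∂P := by
          congr 1
          funext a
          rw [← integral_mul_const]
          congr 1
          funext x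
          rw [← Real.exp_add]
          congr 1
          ring
      _ ≤ ∫ a, Real.exp ((n * v : NNReal) * t ^ 2 / 2) *
            Real.exp (t * (g a - ∫ a, g a ∂P)) ∂P := by
          have hdom : ∀ a, ∫ x, Real.exp (t * (F a x - g a)) ∂π ≤
              Real.exp ((n * v : NNReal) * t ^ 2 / 2) := fun a =>
            (ih (F a) (hFB a) (hFc a)).mgf_le t
          refine integral_mono_of_nonneg (Filter.Eventually.of_forall fun a => ?_)
            ((integrable_exp_of_abs_le P hgB t _).const_mul _)
            (Filter.Eventually.of_forall fun a => ?_)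
          · exact mul_nonneg (integral_nonneg fun x => (Real.exp_pos _).le) (Real.exp_pos _).le
          · exact mul_le_mul_of_nonneg_right (hdom a) (Real.exp_pos _).le
      _ = Real.exp ((n * v : NNReal) * t ^ 2 / 2) *
            ∫ a, Real.exp (t * (g a - ∫ a, g a ∂P)) ∂P := integral_const_mul _ _
      _ ≤ Real.exp ((n * v : NNReal) * t ^ 2 / 2) * Real.exp (v * t ^ 2 / 2) := by
          gcongr
          exact hHoeff.mgf_le t
      _ = Real.exp (((n + 1 : ℕ) * v : NNReal) * t ^ 2 / 2) := by
          rw [← Real.exp_add]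
          congr 1
          push_cast
          ring

end BoundedDifferences

/-! ### The mass lost by truncation. -/

lemma rank_ne_top {μ : ℕ → ℝ≥0∞} (hμ : ∑' i, μ i ≠ ∞) {i : ℕ} (hi : μ i ≠ 0) : rank μ i ≠ ⊤ := by
  rw [rank, Set.encard_ne_top_iff]
  refine (ENNReal.finite_const_le_of_tsum_ne_top hμ hi).subset ?_
  rintro j (hj | hj)
  · exact hj.le
  · exact hj.1.ge

lemma tsum_decr_add (μ : ℕ → ℝ≥0∞) (t : ℕ) :
    ∑' k, decr μ (t + k) = ∑' i, Set.indicator {i | (t : ℕ∞) ≤ rank μ i ∧ rank μ i ≠ ⊤} μ i := by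
  simp only [decr]
  rw [ENNReal.tsum_comm]
  refine tsum_congr fun i => ?_
  by_cases h : (t : ℕ∞) ≤ rank μ i ∧ rank μ i ≠ ⊤
  · rw [Set.indicator_of_mem (by exact h)]
    obtain ⟨r, hr⟩ := ENat.ne_top_iff_exists.1 h.2
    have htr : t ≤ r := by
      have := h.1
      rw [← hr] at this
      exact_mod_cast this
    rw [tsum_eq_single (r - t)]
    · rw [Set.indicator_of_mem]
      show rank μ i = _
      rw [← hr, Nat.add_sub_cancel' htr]
    · intro k hk
      rw [Set.indicator_of_notMem]
      intro hmem
      have hmem : rank μ i = ((t + k : ℕ) : ℕ∞) := hmem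
      rw [← hr] at hmem
      have : r = t + k := by exact_mod_cast hmem
      omega
  · rw [Set.indicator_of_notMem (by exact h), ENNReal.tsum_eq_zero]
    intro k
    rw [Set.indicator_of_notMem]
    intro hmem
    have hmem : rank μ i = ((t + k : ℕ) : ℕ∞) := hmem
    refine h ⟨?_, ?_⟩
    · rw [hmem]
      exact_mod_cast Nat.le_add_right t k
    · rw [hmem]
      exact ENat.natCast_ne_top _

/-- The mass outside the truncation is less than the truncation level. -/
lemma tsum_lt_tsum_truncate_add {μ : ℕ → ℝ≥0∞} (hμ : ∑' i, μ i ≠ ∞) {η : ℝ} (hη : 0 < η) :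
    ∑' i, μ i < ∑' i, truncate μ η i + ENNReal.ofReal η := by
  -- Nonemptiness is needed for the infimum defining `truncIndex` to be attained; on an empty set
  -- `sInf` would return `0`.
  have hne : {t : ℕ | ∑' k, decr μ (t + k) < ENNReal.ofReal η}.Nonempty := by
    have hsum : ∑' k, decr μ k ≠ ∞ := by
      have h0 := tsum_decr_add μ 0
      simp only [zero_add] at h0
      rw [h0]
      exact ne_top_of_le_ne_top hμ (ENNReal.tsum_le_tsum fun i => Set.indicator_le_self _ _ _)
    have hev := (ENNReal.tendsto_sum_nat_add _ hsum).eventually_lt_const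
      (ENNReal.ofReal_pos.2 hη)
    obtain ⟨t, ht⟩ := hev.exists
    exact ⟨t, by simpa only [Set.mem_ofPred_eq, add_comm] using ht⟩
  have hT : ∑' k, decr μ (truncIndex μ η + k) < ENNReal.ofReal η := Nat.sInf_mem hne
  rw [tsum_decr_add] at hT
  have hsplit : ∑' i, μ i = ∑' i, truncate μ η i + ∑' i, Set.indicator
      {i | (truncIndex μ η : ℕ∞) ≤ rank μ i ∧ rank μ i ≠ ⊤} μ i := by
    rw [← ENNReal.tsum_add]
    refine tsum_congr fun i => ?_
    rw [truncate]
    by_cases hlt : rank μ i < truncIndex μ η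
    · rw [Set.indicator_of_mem (by exact hlt), Set.indicator_of_notMem, add_zero]
      exact fun h => (not_le.2 hlt) h.1
    · rw [Set.indicator_of_notMem (by exact hlt), zero_add]
      by_cases h0 : μ i = 0
      · simp [Set.indicator_apply, h0]
      · rw [Set.indicator_of_mem]
        exact ⟨not_lt.1 hlt, rank_ne_top hμ h0⟩
  rw [hsplit]
  refine ENNReal.add_lt_add_left ?_ hT
  exact ne_top_of_le_ne_top hμ (ENNReal.tsum_le_tsum fun i => Set.indicator_le_self _ _ _)

/-- A finite set carrying all but `η` of the mass, with half-norm controlled by the truncation. -/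
lemma exists_finset_of_halfNorm_truncate_le (μ : PMF ℕ) {η Λ : ℝ} (hη : 0 < η) (hΛ : 0 ≤ Λ)
    (h : halfNorm (truncate μ η) ≤ ENNReal.ofReal Λ) :
    ∃ F : Finset ℕ, ∑ i ∈ F, √(mass μ i) ≤ √Λ ∧ 1 - ∑ i ∈ F, mass μ i < η := by
  classical
  have h1 := tsum_lt_tsum_truncate_add μ.tsum_coe_ne_top hη
  -- The strict inequality survives passing to a finite partial sum, which makes the set finite.
  rw [μ.tsum_coe, ENNReal.tsum_eq_iSup_sum, ENNReal.iSup_add, lt_iSup_iff] at h1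
  obtain ⟨s, hs⟩ := h1
  refine ⟨s.filter fun i => rank μ i < truncIndex μ η, ?_, ?_⟩
  · have hle : (∑ i ∈ s.filter (fun i => rank μ i < truncIndex μ η), μ i ^ (1 / 2 : ℝ)) ^ 2 ≤
        ENNReal.ofReal Λ := by
      refine le_trans ?_ h
      unfold halfNorm
      gcongr
      refine le_trans ?_ (ENNReal.sum_le_tsum (s.filter fun i => rank μ i < truncIndex μ η))
      refine Finset.sum_le_sum fun i hi => le_of_eq ?_
      rw [truncate, Set.indicator_of_mem (by exact (Finset.mem_filter.1 hi).2)]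
    have hreal := ENNReal.toReal_mono ENNReal.ofReal_ne_top hle
    rw [ENNReal.toReal_pow, ENNReal.toReal_ofReal hΛ, ENNReal.toReal_sum fun i _ =>
      ENNReal.rpow_ne_top_of_nonneg (by norm_num) (μ.apply_ne_top i)] at hreal
    refine Real.le_sqrt_of_sq_le (le_trans (le_of_eq ?_) hreal)
    congr 1
    refine Finset.sum_congr rfl fun i _ => ?_
    rw [← ENNReal.toReal_rpow, Real.sqrt_eq_rpow, mass]
  · have hsum : ∑ i ∈ s, truncate μ η i =
        ∑ i ∈ s.filter (fun i => rank μ i < truncIndex μ η), μ i := by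
      rw [Finset.sum_filter]
      exact Finset.sum_congr rfl fun i _ => by simp [truncate, Set.indicator_apply]
    rw [hsum] at hs
    have hfin : ∑ i ∈ s.filter (fun i => rank μ i < truncIndex μ η), μ i ≠ ∞ :=
      ENNReal.sum_ne_top.2 fun i _ => μ.apply_ne_top i
    have := (ENNReal.toReal_lt_toReal ENNReal.one_ne_top
      (ENNReal.add_ne_top.2 ⟨hfin, ENNReal.ofReal_ne_top⟩)).2 hs
    rw [ENNReal.toReal_add hfin ENNReal.ofReal_ne_top, ENNReal.toReal_ofReal hη.le,
      ENNReal.toReal_sum fun i _ => μ.apply_ne_top i, ENNReal.toReal_one] at this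
    simp only [mass]
    linarith

/-! ### Upper bound: concentration of the empirical measure. -/

section Empirical

variable {m : ℕ}

lemma empirical_nonneg (X : Fin m → ℕ) (i : ℕ) : 0 ≤ empirical X i :=
  mul_nonneg (by positivity) (Finset.sum_nonneg fun t _ => by split_ifs <;> norm_num)

lemma hasSum_empirical (hm : 0 < m) (X : Fin m → ℕ) : HasSum (empirical X) 1 := by
  have h : HasSum (fun i => ∑ t : Fin m, if X t = i then (1 : ℝ) else 0) (∑ _t : Fin m, 1) :=
    hasSum_sum fun t _ => by simpa only [eq_comm] using hasSum_ite_eq (X t) (1 : ℝ)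
  have h2 : HasSum (empirical X) (1 / (m : ℝ) * ∑ _t : Fin m, 1) := h.mul_left (1 / (m : ℝ))
  have hm' : (m : ℝ) ≠ 0 := by positivity
  rwa [Finset.sum_const, Finset.card_univ, Fintype.card_fin, nsmul_eq_mul, mul_one,
    one_div_mul_cancel hm'] at h2

lemma sum_empirical_le_one (hm : 0 < m) (X : Fin m → ℕ) (F : Finset ℕ) :
    ∑ i ∈ F, empirical X i ≤ 1 :=
  sum_le_hasSum F (fun i _ => empirical_nonneg X i) (hasSum_empirical hm X)

/-- Off `F` the difference is bounded by `e + p`; both masses off `F` are one minus those on `F`. -/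
lemma tv_empirical_le (hm : 0 < m) (X : Fin m → ℕ) (μ : PMF ℕ) (F : Finset ℕ) :
    tv (empirical X) (mass μ) ≤ 1 / 2 * ∑ i ∈ F, |empirical X i - mass μ i| +
      1 / 2 * ((1 - ∑ i ∈ F, empirical X i) + (1 - ∑ i ∈ F, mass μ i)) := by
  set e := empirical X
  set p := mass μ
  have he : HasSum e 1 := hasSum_empirical hm X
  have hp : HasSum p 1 := tsum_mass μ ▸ (summable_mass μ).hasSum
  have hF : HasSum (fun i => if i ∈ F then |e i - p i| - e i - p i else 0)
      (∑ i ∈ F, if i ∈ F then |e i - p i| - e i - p i else 0) :=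
    hasSum_sum_of_ne_finset_zero (fun b hb => by simp [hb])
  have hall := hF.add (he.add hp)
  rw [Finset.sum_congr rfl (fun i hi => if_pos hi)] at hall
  have hle : ∑' i, |e i - p i| ≤ ∑ i ∈ F, (|e i - p i| - e i - p i) + (1 + 1) := by
    rw [← hall.tsum_eq]
    refine Summable.tsum_le_tsum (fun i => ?_) (he.summable.sub hp.summable).abs hall.summable
    by_cases hi : i ∈ F
    · simp only [hi, if_true]; linarith
    · simp only [hi, if_false, zero_add]
      have h1 : 0 ≤ e i := empirical_nonneg X i
      have h2 : 0 ≤ p i := mass_nonneg μ i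
      rw [abs_le]
      constructor <;> linarith
  rw [Finset.sum_sub_distrib, Finset.sum_sub_distrib] at hle
  unfold tv
  linarith

instance (μ : PMF ℕ) (m : ℕ) : IsProbabilityMeasure (sampleLaw μ m) := by
  unfold sampleLaw
  infer_instance

lemma integral_indicator_mass (μ : PMF ℕ) (i : ℕ) :
    ∫ x, (if x = i then (1 : ℝ) else 0) ∂μ.toMeasure = mass μ i := by
  have : (fun x : ℕ => if x = i then (1 : ℝ) else 0) = Set.indicator {i} 1 := by
    funext x
    simp [Set.indicator_apply]
  rw [this, integral_indicator_one (measurableSet_singleton i), Measure.real,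
    PMF.toMeasure_apply_singleton _ _ (measurableSet_singleton i), mass]

lemma abs_ite_le_one (p : Prop) [Decidable p] : |if p then (1 : ℝ) else 0| ≤ 1 := by
  split_ifs <;> simp

lemma integral_empirical (μ : PMF ℕ) (hm : 0 < m) (i : ℕ) :
    ∫ X, empirical X i ∂sampleLaw μ m = mass μ i := by
  simp only [empirical]
  rw [integral_const_mul, integral_finsetSum]
  · have hm' : (m : ℝ) ≠ 0 := by positivity
    have : ∀ t : Fin m, ∫ X : Fin m → ℕ, (if X t = i then (1 : ℝ) else 0) ∂sampleLaw μ m =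
        mass μ i := by
      intro t
      rw [← integral_indicator_mass μ i]
      exact integral_comp_eval (μ := fun _ : Fin m => μ.toMeasure)
        (f := fun x => if x = i then (1 : ℝ) else 0)
        (measurable_of_countable _).aestronglyMeasurable
    simp only [this, Finset.sum_const, Finset.card_univ, Fintype.card_fin, nsmul_eq_mul]
    field_simp
  · exact fun t _ => integrable_of_abs_le _ fun X => abs_ite_le_one _

lemma empirical_le_one (hm : 0 < m) (X : Fin m → ℕ) (i : ℕ) : empirical X i ≤ 1 := by
  simpa using sum_empirical_le_one hm X {i}

lemma abs_empirical_sub_le (μ : PMF ℕ) (hm : 0 < m) (X : Fin m → ℕ) (i : ℕ) :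
    |empirical X i - mass μ i| ≤ 1 := by
  have h1 := empirical_le_one hm X i
  have h2 := empirical_nonneg X i
  have h3 := mass_nonneg μ i
  have h4 : mass μ i ≤ 1 := by simpa using sum_mass_le_one μ {i}
  rw [abs_le]
  constructor <;> linarith

lemma memLp_of_abs_le {Ω : Type*} [MeasurableSpace Ω] [Countable Ω]
    [MeasurableSingletonClass Ω] (P : Measure Ω) [IsProbabilityMeasure P] {h : Ω → ℝ} {B : ℝ}
    (hB : ∀ x, |h x| ≤ B) : MemLp h 2 P :=
  MemLp.of_bound (measurable_of_countable h).aestronglyMeasurable B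
    (Filter.Eventually.of_forall hB)

lemma variance_empirical_le (μ : PMF ℕ) (hm : 0 < m) (i : ℕ) :
    ProbabilityTheory.variance (fun X => empirical X i) (sampleLaw μ m) ≤ mass μ i / m := by
  have hm' : (0 : ℝ) < m := by positivity
  have hsum := ProbabilityTheory.variance_sum_pi (μ := fun _ : Fin m => μ.toMeasure)
    (X := fun _ x => if x = i then (1 : ℝ) else 0)
    (fun t => memLp_of_abs_le μ.toMeasure fun x => abs_ite_le_one _)
  have hvar : ProbabilityTheory.variance (fun x : ℕ => if x = i then (1 : ℝ) else 0) μ.toMeasure ≤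
      mass μ i := by
    refine (ProbabilityTheory.variance_le_expectation_sq
      (measurable_of_countable _).aestronglyMeasurable).trans (le_of_eq ?_)
    rw [← integral_indicator_mass μ i]
    congr 1
    funext x
    simp
  have : (fun X : Fin m → ℕ => empirical X i) =
      fun X => (1 / (m : ℝ)) * (∑ t, fun X : Fin m → ℕ => if X t = i then (1 : ℝ) else 0) X := by
    funext X
    simp [empirical]
  rw [this, ProbabilityTheory.variance_const_mul, sampleLaw, hsum]
  simp only [Finset.sum_const, Finset.card_univ, Fintype.card_fin, nsmul_eq_mul]
  calc (1 / (m : ℝ)) ^ 2 * (m * _) ≤ (1 / (m : ℝ)) ^ 2 * (m * mass μ i) := by gcongr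
    _ = mass μ i / m := by field_simp

/-- Jensen, obtained from the nonnegativity of the variance of the absolute deviation. -/
lemma integral_abs_empirical_sub_le (μ : PMF ℕ) (hm : 0 < m) (i : ℕ) :
    ∫ X, |empirical X i - mass μ i| ∂sampleLaw μ m ≤ √(mass μ i / m) := by
  refine Real.le_sqrt_of_sq_le (le_trans ?_ (variance_empirical_le μ hm i))
  have h1 := ProbabilityTheory.variance_nonneg (fun X => |empirical X i - mass μ i|)
    (sampleLaw μ m)
  rw [ProbabilityTheory.variance_eq_sub (memLp_of_abs_le _ fun X => by
    rw [abs_abs]; exact abs_empirical_sub_le μ hm X i)] at h1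
  rw [ProbabilityTheory.variance_eq_integral (measurable_of_countable _).aemeasurable,
    integral_empirical μ hm]
  simp only [Pi.pow_apply, sq_abs] at h1
  linarith

/-- The part of the total variation error of the empirical measure carried by `F`. -/
def partialError (μ : PMF ℕ) (F : Finset ℕ) (X : Fin m → ℕ) : ℝ :=
  1 / 2 * ∑ i ∈ F, |empirical X i - mass μ i|

lemma abs_partialError_le (μ : PMF ℕ) (F : Finset ℕ) (hm : 0 < m) (X : Fin m → ℕ) :
    |partialError μ F X| ≤ 1 := by
  have h0 : 0 ≤ ∑ i ∈ F, |empirical X i - mass μ i| := Finset.sum_nonneg fun i _ => abs_nonneg _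
  have h1 : ∑ i ∈ F, |empirical X i - mass μ i| ≤ ∑ i ∈ F, (empirical X i + mass μ i) := by
    refine Finset.sum_le_sum fun i _ => ?_
    have h2 := empirical_nonneg X i
    have h3 := mass_nonneg μ i
    rw [abs_le]
    constructor <;> linarith
  rw [Finset.sum_add_distrib] at h1
  have h2 := sum_empirical_le_one hm X F
  have h3 := sum_mass_le_one μ F
  rw [partialError, abs_of_nonneg (by positivity)]
  linarith

lemma sum_ite_eq_le_one (F : Finset ℕ) (x : ℕ) : ∑ i ∈ F, (if x = i then (1 : ℝ) else 0) ≤ 1 := by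
  rw [Finset.sum_ite_eq]
  split_ifs <;> norm_num

/-- Replacing one draw moves mass `1/m` between two points, an `ℓ¹` change of at most `2/m`, which
is then halved. -/
lemma partialError_update_sub_le (μ : PMF ℕ) (F : Finset ℕ) (X : Fin m → ℕ) (t : Fin m) (y : ℕ) :
    |partialError μ F (Function.update X t y) - partialError μ F X| ≤ 1 / m := by
  have hdiff : ∀ i, |empirical (Function.update X t y) i - empirical X i| ≤
      (1 / m : ℝ) * ((if y = i then 1 else 0) + if X t = i then 1 else 0) := by
    intro i
    have : empirical (Function.update X t y) i - empirical X i =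
        1 / m * ((if y = i then 1 else 0) - if X t = i then 1 else 0) := by
      simp only [empirical]
      rw [← mul_sub, ← Finset.sum_sub_distrib, Finset.sum_eq_single t]
      · simp
      · intro s _ hs
        simp [Function.update_of_ne hs]
      · simp
    rw [this, abs_mul, abs_of_nonneg (by positivity)]
    gcongr
    split_ifs <;> norm_num
  rw [partialError, partialError, ← mul_sub, ← Finset.sum_sub_distrib, abs_mul,
    abs_of_nonneg (by norm_num)]
  calc 1 / 2 * |∑ i ∈ F, (|empirical (Function.update X t y) i - mass μ i| -
        |empirical X i - mass μ i|)|
      ≤ 1 / 2 * ∑ i ∈ F, (1 / m : ℝ) * ((if y = i then 1 else 0) + if X t = i then 1 else 0) := by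
        gcongr
        refine (Finset.abs_sum_le_sum_abs _ _).trans (Finset.sum_le_sum fun i _ => ?_)
        refine (abs_abs_sub_abs_le_abs_sub _ _).trans ?_
        rw [sub_sub_sub_cancel_right]
        exact hdiff i
    _ ≤ 1 / 2 * (1 / m * (1 + 1)) := by
        rw [← Finset.mul_sum, Finset.sum_add_distrib]
        gcongr <;> exact sum_ite_eq_le_one _ _
    _ = 1 / m := by ring

lemma integral_partialError_le (μ : PMF ℕ) (F : Finset ℕ) (hm : 0 < m) :
    ∫ X, partialError μ F X ∂sampleLaw μ m ≤ 1 / 2 * ((∑ i ∈ F, √(mass μ i)) / √m) := by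
  simp only [partialError]
  rw [integral_const_mul, integral_finsetSum, Finset.sum_div]
  · gcongr with i
    rw [← Real.sqrt_div (mass_nonneg μ i)]
    exact integral_abs_empirical_sub_le μ hm i
  · exact fun i _ => integrable_of_abs_le _ fun X => by
      rw [abs_abs]; exact abs_empirical_sub_le μ hm X i

lemma partialError_tail (μ : PMF ℕ) (F : Finset ℕ) (hm : 0 < m) {s : ℝ} (hs : 0 ≤ s) :
    (sampleLaw μ m).real
      {X | s ≤ partialError μ F X - ∫ Y, partialError μ F Y ∂sampleLaw μ m} ≤
      Real.exp (-(2 * m * s ^ 2)) := by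
  have h := (hasSubgaussianMGF_of_bounded_differences μ.toMeasure (1 / m) 1 m (partialError μ F)
    (abs_partialError_le μ F hm) (partialError_update_sub_le μ F)).measure_ge_le hs
  refine h.trans (le_of_eq ?_)
  congr 1
  have hm' : (m : ℝ) ≠ 0 := by positivity
  push_cast
  rw [Real.norm_of_nonneg (by positivity)]
  field_simp

/-- Markov's inequality, as the empirical mass off `F` has the true mass off `F` as its mean. -/
lemma unseen_tail (μ : PMF ℕ) (F : Finset ℕ) (hm : 0 < m) (s : ℝ) :
    s * (sampleLaw μ m).real {X | s ≤ 1 - ∑ i ∈ F, empirical X i} ≤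
      1 - ∑ i ∈ F, mass μ i := by
  have hint : ∀ i, Integrable (fun X : Fin m → ℕ => empirical X i) (sampleLaw μ m) := fun i =>
    integrable_of_abs_le _ fun X => by
      rw [abs_of_nonneg (empirical_nonneg X i)]; exact empirical_le_one hm X i
  have hsum := integrable_finsetSum F fun i _ => hint i
  have := mul_meas_ge_le_integral_of_nonneg (μ := sampleLaw μ m)
    (f := fun X => 1 - ∑ i ∈ F, empirical X i)
    (Filter.Eventually.of_forall fun X => sub_nonneg.2 (sum_empirical_le_one hm X F))
    ((integrable_const 1).sub hsum) s
  rw [integral_sub (integrable_const 1) hsum, integral_finsetSum _ fun i _ => hint i] at this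
  simpa only [integral_empirical μ hm, integral_const, probReal_univ, smul_eq_mul, mul_one]
    using this

/-- The high-probability guarantee of the empirical measure. -/
theorem empirical_accurate {Λ ε δ : ℝ} (hΛ : 2 ≤ Λ) (hε : 0 < ε) (hδ : 0 < δ)
    (hδ1 : δ < 1) (μ : PMF ℕ)
    (hμ : halfNorm (truncate μ (2 * ε * δ / 9)) ≤ ENNReal.ofReal Λ)
    (h : 9 / ε ^ 2 * max Λ (Real.log (1 / δ)) ≤ (m : ℝ)) :
    1 - δ ≤ (sampleLaw μ m).real {X | tv (empirical X) (mass μ) < ε} := by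
  have hmax : 9 * max Λ (Real.log (1 / δ)) ≤ m * ε ^ 2 := by
    rwa [div_mul_eq_mul_div, div_le_iff₀ (by positivity)] at h
  have hL := le_max_left Λ (Real.log (1 / δ))
  have hR := le_max_right Λ (Real.log (1 / δ))
  have hmpos : (0 : ℝ) < m := by
    by_contra hcon
    nlinarith [sq_nonneg ε]
  have hm : 0 < m := by exact_mod_cast hmpos
  obtain ⟨F, hF1, hF2⟩ := exists_finset_of_halfNorm_truncate_le μ (by positivity) (by linarith) hμ
  set A := {X : Fin m → ℕ |
    ε / 3 ≤ partialError μ F X - ∫ Y, partialError μ F Y ∂sampleLaw μ m}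
  set B := {X : Fin m → ℕ | 4 * ε / 9 ≤ 1 - ∑ i ∈ F, empirical X i}
  have hmean : ∫ Y, partialError μ F Y ∂sampleLaw μ m ≤ ε / 3 := by
    refine (integral_partialError_le μ F hm).trans ?_
    have : (∑ i ∈ F, √(mass μ i)) / √m ≤ ε / 3 := by
      rw [div_le_iff₀ (Real.sqrt_pos.2 hmpos)]
      refine hF1.trans (Real.sqrt_le_iff.2 ⟨by positivity, ?_⟩)
      rw [mul_pow, Real.sq_sqrt hmpos.le]
      linarith
    linarith
  have hA : (sampleLaw μ m).real A ≤ δ / 2 := by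
    refine (partialError_tail μ F hm (by positivity)).trans ?_
    -- Here `2mε²/9` is at least twice the maximum, hence at least `Λ + ln(1/δ)`; the spare `Λ ≥ 1`
    -- yields `exp(-1) ≤ 1/2`.
    have h2 : -(2 * m * (ε / 3) ^ 2) ≤ Real.log δ + -1 := by
      rw [one_div, Real.log_inv] at hR hmax hL
      nlinarith
    refine (Real.exp_le_exp.2 h2).trans ?_
    rw [Real.exp_add, Real.exp_log hδ, Real.exp_neg]
    have h3 : (2 : ℝ) ≤ Real.exp 1 := by linarith [Real.add_one_le_exp (1 : ℝ)]
    have h4 := inv_anti₀ (by norm_num) h3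
    nlinarith
  have hB : (sampleLaw μ m).real B ≤ δ / 2 := by
    have h2 := (unseen_tail μ F hm (4 * ε / 9)).trans hF2.le
    have h3 : 4 * ε / 9 * (sampleLaw μ m).real B ≤ 4 * ε / 9 * (δ / 2) := h2.trans_eq (by ring)
    exact le_of_mul_le_mul_left h3 (by positivity)
  have hsub : (A ∪ B)ᶜ ⊆ {X | tv (empirical X) (mass μ) < ε} := by
    intro X hX
    have hXA : ¬ ε / 3 ≤ partialError μ F X - ∫ Y, partialError μ F Y ∂sampleLaw μ m :=
      fun hc => hX (Or.inl hc)
    have hXB : ¬ 4 * ε / 9 ≤ 1 - ∑ i ∈ F, empirical X i := fun hc => hX (Or.inr hc)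
    have h2 := tv_empirical_le hm X μ F
    change _ ≤ partialError μ F X + _ at h2
    show tv (empirical X) (mass μ) < ε
    -- The budget is `ε/3` for the mean, `ε/3` for the deviation, and `(4ε/9 + 2ε/9)/2 = ε/3` off
    -- `F`.
    have : 2 * ε * δ / 9 ≤ 2 * ε / 9 := by
      have := mul_le_of_le_one_right hε.le hδ1.le
      linarith
    linarith
  have hcompl : (sampleLaw μ m).real (A ∪ B)ᶜ = 1 - (sampleLaw μ m).real (A ∪ B) :=
    probReal_compl_eq_one_sub (Set.to_countable _).measurableSet
  have hunion := measureReal_union_le (μ := sampleLaw μ m) A B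
  have hmono := measureReal_mono (μ := sampleLaw μ m) hsub
  linarith

end Empirical

end DiscreteEstimation

end

theorem theorem6 :
    (∃ C : ℝ, 0 < C ∧
      ∀ Λ ε δ : ℝ, 2 ≤ Λ → 0 < ε → ε < 1 → 0 < δ → δ < 1 →
        ∀ μ : PMF ℕ,
          DiscreteEstimation.halfNorm (DiscreteEstimation.truncate μ (2 * ε * δ / 9))
            ≤ ENNReal.ofReal Λ →
          ∀ m : ℕ, C / ε ^ 2 * max Λ (Real.log (1 / δ)) ≤ (m : ℝ) →
            1 - δ ≤ (DiscreteEstimation.sampleLaw μ m).real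
              {X | DiscreteEstimation.tv (DiscreteEstimation.empirical X)
                (DiscreteEstimation.mass μ) < ε}) ∧
    (∃ c : ℝ, 0 < c ∧
      ∀ Λ ε δ : ℝ, 2 ≤ Λ → 0 < ε → ε < 1 / 16 → 0 < δ → δ < 1 →
        (∀ (m : ℕ) (est : (Fin m → ℕ) → PMF ℕ), ∃ μ : PMF ℕ,
          DiscreteEstimation.halfNorm (DiscreteEstimation.truncate μ (ε / 18))
            ≤ ENNReal.ofReal Λ ∧
          (3 / 4 ≤ (DiscreteEstimation.sampleLaw μ m).real
              {X | DiscreteEstimation.tv (DiscreteEstimation.mass (est X))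
                (DiscreteEstimation.mass μ) < ε} →
            c / ε ^ 2 * Λ ≤ (m : ℝ))) ∧
        (∀ (m : ℕ) (est : (Fin m → ℕ) → PMF ℕ), ∃ ν : PMF ℕ,
          DiscreteEstimation.halfNorm (DiscreteEstimation.truncate ν (2 * ε * δ / 9))
            ≤ ENNReal.ofReal Λ ∧
          (1 - δ ≤ (DiscreteEstimation.sampleLaw ν m).real
              {X | DiscreteEstimation.tv (DiscreteEstimation.mass (est X))
                (DiscreteEstimation.mass ν) < ε} →
            c / ε ^ 2 * Real.log (1 / δ) ≤ (m : ℝ)))) := by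
  refine ⟨⟨9, by norm_num, ?_⟩, 1 / 3072, by norm_num, ?_⟩
  · intro Λ ε δ hΛ hε _ hδ hδ1 μ hμ m hm
    exact DiscreteEstimation.empirical_accurate hΛ hε hδ hδ1 μ hμ hm
  · intro Λ ε δ hΛ hε hε1 hδ hδ1
    exact ⟨fun _ est => DiscreteEstimation.exists_halfNorm_lower hΛ hε hε1 est,
      fun _ est => DiscreteEstimation.exists_log_lower hΛ hε hε1 hδ hδ1 est⟩
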